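/- Let $n\ge 1$, let $C(S^1)^{(n)}\subseteq M_n(\mathbb C)$ be the operator system of complex $n\times n$ Toeplitz matrices, and let $H\neq\{0\}$ be a complex Hilbert space of arbitrary (finite or infinite) dimension. Let $\mathcal C=\left(C(S^1)^{(n)}\otimes_{\min}B(H)\right)_+$ be the positive cone of the minimal (spatial) operator system tensor product, that is, the set of those elements of the algebraic tensor product $C(S^1)^{(n)}\otimes B(H)$ that act as positive operators on the Hilbert space $\mathbb C^n\otimes H$. An element $\phi\in\mathcal C$ is called pure (it generates an extremal ray of $\mathcal C$, the ray $\{0\}$ being admitted) if, whenever $\vartheta+\omega=\phi$ with $\vartheta,\omega\in\mathcal C$, there is $s\in[0,1]$ such that $\vartheta=s\phi$ and $\omega=(1-s)\phi$. For $z\in S^1$ let $T_n(z)=[z^{k-l}]_{k,l=1}^{n}\in C(S^1)^{(n)}$. Then an element $T\in C(S^1)^{(n)}\otimes B(H)$ is a pure element of $\mathcal C$ if and only if there exist $\lambda\in S^1$, a rank-one projection $Q\in B(H)$ (that is, $Q=Q^*=Q^2$ with one-dimensional range) and a real number $\alpha\ge 0$ such that $$T=T_n(\lambda^{-1})\otimes(\alpha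 Q).$$ -/

import Mathlib

open scoped TensorProduct

noncomputable section

/-- The space of `n × n` complex Toeplitz matrices: the `(k, l)` entry depends only on `k - l`. -/
def toeplitz (n : ℕ) : Submodule ℂ (Matrix (Fin n) (Fin n) ℂ) where
  carrier := {t | ∃ τ : ℤ → ℂ, ∀ k l : Fin n, t k l = τ ((k : ℤ) - (l : ℤ))}
  zero_mem' := ⟨0, fun _ _ => rfl⟩
  add_mem' := by
    rintro a b ⟨τ, hτ⟩ ⟨σ, hσ⟩
    exact ⟨τ + σ, fun k l => by simp [hτ, hσ]⟩
  smul_mem' := by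
    rintro c a ⟨τ, hτ⟩
    exact ⟨c • τ, fun k l => by simp [hτ]⟩

/-- The universal positive Toeplitz matrix `T_n(z)`, `z ∈ S¹`, with `(k, l)` entry `z ^ (k - l)`. -/
def universalToeplitz (n : ℕ) (z : Circle) : toeplitz n :=
  ⟨Matrix.of fun k l => (z : ℂ) ^ ((k : ℤ) - (l : ℤ)), fun m => (z : ℂ) ^ m, fun _ _ => rfl⟩

section Spatial

variable (n : ℕ) (H : Type*) [NormedAddCommGroup H] [InnerProductSpace ℂ H]

/-- The Hilbert space `ℂⁿ ⊗ H`, realised as the `ℓ²` direct sum of `n` copies of `H`. -/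
abbrev HilbertPower : Type _ := PiLp 2 (fun _ : Fin n => H)

variable {n H}

/-- The operator `a ⊗ x` on `ℂⁿ ⊗ H`, i.e. the operator matrix with `(i, j)` entry `a i j • x`. -/
def kroneckerOp (a : Matrix (Fin n) (Fin n) ℂ) (x : H →L[ℂ] H) :
    HilbertPower n H →L[ℂ] HilbertPower n H :=
  ((PiLp.continuousLinearEquiv 2 ℂ (fun _ : Fin n => H)).symm :
      (Fin n → H) →L[ℂ] HilbertPower n H) ∘L
    ContinuousLinearMap.pi fun i =>
      ∑ j, a i j • (x ∘L PiLp.proj 2 (fun _ : Fin n => H) j)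

theorem kroneckerOp_apply (a : Matrix (Fin n) (Fin n) ℂ) (x : H →L[ℂ] H)
    (ξ : HilbertPower n H) (i : Fin n) :
    kroneckerOp a x ξ i = ∑ j, a i j • x (ξ j) := by
  simp [kroneckerOp]

variable (n H)

/-- The spatial representation of the algebraic tensor product of the Toeplitz matrices with
`B(H)` as operators on `ℂⁿ ⊗ H`; it sends `∑ a_i ⊗ x_i` to the block Toeplitz operator. -/
def spatialRep :
    (toeplitz n ⊗[ℂ] (H →L[ℂ] H)) →ₗ[ℂ] (HilbertPower n H →L[ℂ] HilbertPower n H) :=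
  TensorProduct.lift <| LinearMap.mk₂ ℂ
    (fun (a : toeplitz n) (x : H →L[ℂ] H) => kroneckerOp (a : Matrix (Fin n) (Fin n) ℂ) x)
    (by intros; ext; simp [kroneckerOp_apply, add_smul, Finset.sum_add_distrib])
    (by intros; ext; simp [kroneckerOp_apply, mul_smul, Finset.smul_sum])
    (by intros; ext; simp [kroneckerOp_apply, Finset.sum_add_distrib])
    (by intro c a x; ext; simp [kroneckerOp_apply, Finset.smul_sum, smul_smul, mul_comm c])

/-- The positive cone of the minimal (spatial) operator system tensor product of the `n × n`
Toeplitz matrices with `B(H)`: the elements acting as positive operators on `ℂⁿ ⊗ H`. -/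
def minPositiveCone : ConvexCone ℝ (toeplitz n ⊗[ℂ] (H →L[ℂ] H)) where
  carrier := {T | (spatialRep n H T).IsPositive}
  smul_mem' := by
    intro c hc T hT
    have h : c • T = (c : ℂ) • T := (algebraMap_smul ℂ c T).symm
    simp only [Set.mem_ofPred_eq, h, map_smul] at hT ⊢
    exact hT.smul_of_nonneg (by exact_mod_cast hc.le)
  add_mem' := by
    intro S hS T hT
    simp only [Set.mem_ofPred_eq, map_add] at hS hT ⊢
    exact hS.add hT

end Spatial

/-- An element `φ` of a convex cone is pure (generates an extremal ray) if `ϑ + ω = φ` with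
`ϑ, ω` in the cone forces `ϑ = s φ` and `ω = (1 - s) φ` for some `s ∈ [0, 1]`. -/
def IsPureElement {E : Type*} [AddCommGroup E] [Module ℝ E] (C : ConvexCone ℝ E) (φ : E) : Prop :=
  φ ∈ C ∧ ∀ ϑ ∈ C, ∀ ω ∈ C, ϑ + ω = φ →
    ∃ s ∈ Set.Icc (0 : ℝ) 1, ϑ = s • φ ∧ ω = (1 - s) • φ

/-- A rank-one (orthogonal) projection on a Hilbert space. -/
def IsRankOneProjection {H : Type*} [NormedAddCommGroup H] [InnerProductSpace ℂ H]
    [CompleteSpace H] (Q : H →L[ℂ] H) : Prop :=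
  IsStarProjection Q ∧ Module.finrank ℂ (LinearMap.range (Q : H →ₗ[ℂ] H)) = 1

end

/-!
A pure positive block Toeplitz operator factors as `W† W`. Since its Gram data depend only on index
differences, a contraction `S` maps each column `W e_j` to the next column `W e_{j+1}`, and `W† S W`
is again block Toeplitz: it is `W† W` with its columns shifted by one. Its real and imaginary parts
lie between `-W† W` and `W† W`, so purity makes `W† S W` a scalar multiple of `W† W`. Hence the
blocks along a row form a geometric progression; the Toeplitz condition forces its ratio to be
unimodular, and the operator is `T_n(z) ⊗ P`. Finally `P` is pure in `B(H)₊`, where compressing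
`P = V† V` to `V† E V` by a rank-one projection `E` shows that `P` has rank at most one.
-/

section Cones

variable {E F : Type*} [AddCommGroup E] [Module ℝ E] [AddCommGroup F] [Module ℝ F]

theorem IsPureElement.exists_eq_smul {C : ConvexCone ℝ E} {φ x : E} (hφ : IsPureElement C φ)
    (hadd : φ + x ∈ C) (hsub : φ - x ∈ C) : ∃ r : ℝ, x = r • φ := by
  obtain ⟨s, -, hs, -⟩ := hφ.2 ((1 / 2 : ℝ) • (φ + x)) (C.smul_mem (by norm_num) hadd)
    ((1 / 2 : ℝ) • (φ - x)) (C.smul_mem (by norm_num) hsub) (by module)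
  refine ⟨2 * s - 1, ?_⟩
  rw [sub_smul, mul_smul, ← hs]
  module

theorem IsPureElement.comap {f : E →ₗ[ℝ] F} (hf : Function.Injective f) {C : ConvexCone ℝ F}
    {x : E} (hx : IsPureElement C (f x)) : IsPureElement (C.comap f) x := by
  refine ⟨hx.1, fun ϑ hϑ ω hω h => ?_⟩
  obtain ⟨s, hs, hsϑ, hsω⟩ := hx.2 (f ϑ) hϑ (f ω) hω (by rw [← map_add, h])
  exact ⟨s, hs, hf (by rw [hsϑ, map_smul]), hf (by rw [hsω, map_smul])⟩

end Cones

section CStarAlgebra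

open ComplexStarModule

variable {A : Type*} [CStarAlgebra A]

theorem realPart_star_mul_mul (w s : A) :
    ((ℜ (star w * s * w) : selfAdjoint A) : A) = star w * ((ℜ s : selfAdjoint A) : A) * w := by
  simp only [realPart_apply_coe, star_mul, star_star, mul_assoc, mul_smul_comm, smul_mul_assoc,
    mul_add, add_mul]

variable [PartialOrder A] [StarOrderedRing A]

theorem star_mul_realPart_mul_mem_Icc (w : A) {s : A} (hs : ‖s‖ ≤ 1) :
    ((ℜ (star w * s * w) : selfAdjoint A) : A) ∈ Set.Icc (-(star w * w)) (star w * w) := by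
  have hnorm : algebraMap ℝ A ‖(ℜ s : A)‖ ≤ 1 := by
    rw [← map_one (algebraMap ℝ A)]
    exact algebraMap_mono A ((realPart.norm_le s).trans hs)
  have hle : (ℜ s : A) ≤ 1 := (ℜ s).2.le_algebraMap_norm_self.trans hnorm
  have hge : -1 ≤ (ℜ s : A) := (neg_le_neg hnorm).trans (ℜ s).2.neg_algebraMap_norm_le_self
  rw [realPart_star_mul_mul]
  constructor
  · simpa using star_left_conjugate_le_conjugate hge w
  · simpa using star_left_conjugate_le_conjugate hle w

variable {E : Type*} [AddCommGroup E] [Module ℂ E]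

theorem IsPureElement.exists_eq_complex_smul {f : E →ₗ[ℂ] A} {C : ConvexCone ℝ E}
    (hC : ∀ x, 0 ≤ f x → x ∈ C) {φ x y : E} {w s : A} (hφ : IsPureElement C φ)
    (hfφ : f φ = star w * w) (hs : ‖s‖ ≤ 1) (hx : f x = star w * s * w) (hy : f y = star (f x)) :
    ∃ a : ℂ, x = a • φ := by
  have real_multiple : ∀ {t : A} {u : E}, ‖t‖ ≤ 1 → f u = (ℜ (star w * t * w) : A) →
      ∃ r : ℝ, u = r • φ := by
    intro t u ht hu
    obtain ⟨hge, hle⟩ := star_mul_realPart_mul_mem_Icc w ht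
    refine hφ.exists_eq_smul (hC _ ?_) (hC _ ?_)
    · rw [map_add, hfφ, hu]
      exact neg_le_iff_add_nonneg'.mp hge
    · rw [map_sub, hfφ, hu]
      exact sub_nonneg.mpr hle
  obtain ⟨p, hp⟩ : ∃ r : ℝ, (1 / 2 : ℂ) • (x + y) = r • φ := real_multiple hs (by
    rw [map_smul, map_add, hy, hx, realPart_apply_coe, ← Complex.coe_smul]; simp)
  obtain ⟨q, hq⟩ : ∃ r : ℝ, (-Complex.I / 2 : ℂ) • (x - y) = r • φ :=
    real_multiple (t := -Complex.I • s) (by simpa [norm_smul] using hs) (by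
      rw [mul_smul_comm, smul_mul_assoc, ← hx, map_smul, map_sub, hy, realPart_apply_coe,
        ← Complex.coe_smul, star_smul]
      simp only [RCLike.star_def, map_neg, Complex.conj_I]
      push_cast
      module)
  refine ⟨p + Complex.I * q, ?_⟩
  rw [add_smul, mul_smul, Complex.coe_smul, Complex.coe_smul, ← hp, ← hq, smul_smul,
    show Complex.I * (-Complex.I / 2) = 1 / 2 by linear_combination -Complex.I_mul_I / 2]
  module

end CStarAlgebra

section Gram

variable {𝕜 K : Type*} [RCLike 𝕜] [NormedAddCommGroup K] [InnerProductSpace 𝕜 K] [CompleteSpace K]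

open ContinuousLinearMap

theorem adjoint_apply_apply_of_norm_apply_eq {L : Type*} [NormedAddCommGroup L]
    [InnerProductSpace 𝕜 L] [CompleteSpace L] {S : K →L[𝕜] L} (hS : ‖S‖ ≤ 1) {x : K}
    (hx : ‖S x‖ = ‖x‖) : adjoint S (S x) = x := by
  have hle : ‖adjoint S (S x)‖ ≤ ‖x‖ := by
    simpa [hx] using (adjoint S).le_of_opNorm_le ((LinearIsometryEquiv.norm_map _ S).trans_le hS)
      (S x)
  have hre : RCLike.re (inner 𝕜 (adjoint S (S x)) x) = ‖x‖ ^ 2 := by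
    rw [adjoint_inner_left, inner_self_eq_norm_sq, hx]
  rw [← sub_eq_zero, ← norm_eq_zero, ← sq_eq_zero_iff]
  refine le_antisymm ?_ (sq_nonneg _)
  rw [norm_sub_sq (𝕜 := 𝕜), hre]
  nlinarith [norm_nonneg (adjoint S (S x))]

theorem exists_norm_le_one_apply_eq_of_norm_eq {E F : Type*} [AddCommGroup E] [Module 𝕜 E]
    [NormedAddCommGroup F] [NormedSpace 𝕜 F] [CompleteSpace F] (A : E →ₗ[𝕜] K) (B : E →ₗ[𝕜] F)
    (h : ∀ x, ‖A x‖ = ‖B x‖) : ∃ S : K →L[𝕜] F, ‖S‖ ≤ 1 ∧ ∀ x, S (A x) = B x := by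
  let M := (LinearMap.range A).topologicalClosure
  have : CompleteSpace M := (LinearMap.range A).isClosed_topologicalClosure.completeSpace_coe
  let e : E →ₗ[𝕜] M :=
    Submodule.inclusion (LinearMap.range A).le_topologicalClosure ∘ₗ A.rangeRestrict
  have he : DenseRange e := by
    have hincl : DenseRange (Submodule.inclusion (LinearMap.range A).le_topologicalClosure) :=
      (denseRange_inclusion_iff (LinearMap.range A).le_topologicalClosure).mpr subset_rfl
    exact hincl.comp A.surjective_rangeRestrict.denseRange
      (continuous_inclusion (LinearMap.range A).le_topologicalClosure)
  have hBe : ∀ x, ‖B x‖ ≤ 1 * ‖e x‖ := fun x => by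
    rw [one_mul, ← h x]
    exact le_rfl
  refine ⟨B.extendOfNorm e ∘L M.orthogonalProjectionOnto, ?_, fun x => ?_⟩
  · exact (opNorm_comp_le _ _).trans (mul_le_one₀
      (LinearMap.opNorm_extendOfNorm_le he zero_le_one hBe) (norm_nonneg _)
      M.orthogonalProjectionOnto_norm_le)
  · have hAe : M.orthogonalProjectionOnto (A x) = e x :=
      Submodule.orthogonalProjectionOnto_mem_subspace_eq_self (e x)
    rw [comp_apply, hAe]
    exact LinearMap.extendOfNorm_eq he ⟨1, hBe⟩ x

theorem exists_norm_le_one_apply_eq_of_gram_eq {ι : Type*} {a b : ι → K}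
    (h : ∀ i j, inner 𝕜 (a i) (a j) = inner 𝕜 (b i) (b j)) :
    ∃ S : K →L[𝕜] K, ‖S‖ ≤ 1 ∧ (∀ i, S (a i) = b i) ∧ ∀ i, adjoint S (b i) = a i := by
  have hnorm : ∀ x, ‖Finsupp.linearCombination 𝕜 a x‖ = ‖Finsupp.linearCombination 𝕜 b x‖ := by
    intro x
    rw [← sq_eq_sq₀ (norm_nonneg _) (norm_nonneg _), ← @inner_self_eq_norm_sq 𝕜,
      ← @inner_self_eq_norm_sq 𝕜]
    simp only [Finsupp.linearCombination_apply, Finsupp.sum_inner, Finsupp.inner_sum,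
      inner_smul_left, inner_smul_right, h]
  obtain ⟨S, hS, hSab⟩ := exists_norm_le_one_apply_eq_of_norm_eq _ _ hnorm
  have hSa : ∀ i, S (a i) = b i := fun i => by simpa using hSab (Finsupp.single i 1)
  refine ⟨S, hS, hSa, fun i => ?_⟩
  rw [← hSa, adjoint_apply_apply_of_norm_apply_eq hS]
  simpa [hSa] using (hnorm (Finsupp.single i 1)).symm

end Gram

section RankOne

open ContinuousLinearMap InnerProductSpace

section RCLike

variable {𝕜 K F : Type*} [RCLike 𝕜] [NormedAddCommGroup K] [InnerProductSpace 𝕜 K]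
  [NormedAddCommGroup F] [NormedSpace 𝕜 F]

theorem exists_eq_rankOne_of_forall_inner_eq_zero {v : K} {T : K →L[𝕜] F}
    (h : ∀ x, inner 𝕜 v x = 0 → T x = 0) : ∃ w, T = rankOne 𝕜 w v := by
  refine ⟨((‖v‖ : 𝕜) ^ 2)⁻¹ • T v, ?_⟩
  ext x
  by_cases hv : v = 0
  · simpa [hv] using h x (by simp [hv])
  have hv : (‖v‖ : 𝕜) ^ 2 ≠ 0 := by simpa using hv
  have hx : T (x - (inner 𝕜 v x / (‖v‖ : 𝕜) ^ 2) • v) = 0 := h _ (by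
    rw [inner_sub_right, inner_smul_right, inner_self_eq_norm_sq_to_K, div_mul_cancel₀ _ hv,
      sub_self])
  rw [map_sub, map_smul, sub_eq_zero] at hx
  rw [hx, rankOne_apply, smul_smul, div_eq_mul_inv]

end RCLike

variable {K : Type*} [NormedAddCommGroup K] [InnerProductSpace ℂ K]

theorem real_smul_rankOne_self {c : ℝ} (hc : 0 ≤ c) (v : K) :
    c • rankOne ℂ v v = rankOne ℂ (√c • v) (√c • v) := by
  ext x
  rw [smul_apply, rankOne_apply, rankOne_apply, ← Complex.coe_smul √c, inner_smul_left, smul_smul,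
    mul_right_comm, Complex.conj_ofReal, ← Complex.ofReal_mul, Real.mul_self_sqrt hc, mul_smul,
    Complex.coe_smul]

variable [CompleteSpace K]

theorem exists_eq_star_mul_self_of_isPositive {A : K →L[ℂ] K} (hA : A.IsPositive) :
    ∃ W, A = star W * W :=
  CStarAlgebra.nonneg_iff_eq_star_mul_self.mp ((nonneg_iff_isPositive A).mpr hA)

theorem eq_smul_rankOne_of_nonneg_of_le {A : K →L[ℂ] K} {v : K} (hA : 0 ≤ A)
    (hle : A ≤ rankOne ℂ v v) : ∃ c : ℝ, 0 ≤ c ∧ A = c • rankOne ℂ v v := by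
  obtain ⟨W, rfl⟩ := CStarAlgebra.nonneg_iff_eq_star_mul_self.mp hA
  obtain ⟨w, rfl⟩ : ∃ w, W = rankOne ℂ w v := by
    refine exists_eq_rankOne_of_forall_inner_eq_zero fun x hx => ?_
    have hWx : ‖W x‖ ^ 2 ≤ 0 := by
      simpa [star_eq_adjoint, adjoint_inner_left, hx, ← Complex.ofReal_pow, -sq_nonpos_iff] using
        ((le_def _ _).mp hle).re_inner_nonneg_left x
    simpa using hWx
  refine ⟨‖w‖ ^ 2, by positivity, ?_⟩
  rw [star_eq_adjoint, adjoint_rankOne, mul_def, rankOne_comp_rankOne, inner_self_eq_norm_sq_to_K,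
    ← Complex.coe_smul, Complex.ofReal_pow]
  rfl

theorem isPureElement_rankOne_self (v : K) :
    IsPureElement (ConvexCone.positive ℝ (K →L[ℂ] K)) (rankOne ℂ v v) := by
  refine ⟨(nonneg_iff_isPositive _).mpr (isPositive_rankOne_self v), fun ϑ hϑ ω hω h => ?_⟩
  obtain ⟨c, hc, rfl⟩ := eq_smul_rankOne_of_nonneg_of_le hϑ (h ▸ le_add_of_nonneg_right hω)
  obtain ⟨d, hd, rfl⟩ := eq_smul_rankOne_of_nonneg_of_le hω (h ▸ le_add_of_nonneg_left hϑ)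
  by_cases hv : rankOne ℂ v v = 0
  · exact ⟨0, by simp, by simp [hv], by simp [hv]⟩
  have hcd : c + d = 1 := smul_left_injective ℝ hv (by simpa [add_smul] using h)
  exact ⟨c, ⟨hc, by linarith⟩, rfl, by rw [← hcd, add_sub_cancel_left]⟩

theorem isPureElement_of_map_eq_rankOne_self {E : Type*} [AddCommGroup E] [Module ℝ E]
    {C : ConvexCone ℝ E} {f : E →ₗ[ℝ] (K →L[ℂ] K)} (hf : Function.Injective f)
    (hC : ∀ x, x ∈ C ↔ (f x).IsPositive) {φ : E} {v : K} (hφ : f φ = rankOne ℂ v v) :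
    IsPureElement C φ := by
  have hcomap : C = (ConvexCone.positive ℝ (K →L[ℂ] K)).comap f :=
    SetLike.ext fun x => (hC x).trans (nonneg_iff_isPositive (f x)).symm
  rw [hcomap]
  exact IsPureElement.comap hf (hφ ▸ isPureElement_rankOne_self v)

theorem IsPureElement.exists_eq_rankOne_self {P : K →L[ℂ] K}
    (hP : IsPureElement (ConvexCone.positive ℝ (K →L[ℂ] K)) P) : ∃ v, P = rankOne ℂ v v := by
  obtain ⟨W, rfl⟩ := CStarAlgebra.nonneg_iff_eq_star_mul_self.mp
    (ConvexCone.mem_positive.mp hP.1)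
  by_cases hW : W = 0
  · exact ⟨0, by simp [hW]⟩
  obtain ⟨x, hx⟩ : ∃ x, W x ≠ 0 := DFunLike.ne_iff.mp hW
  let u : K := (‖W x‖ : ℂ)⁻¹ • W x
  have hu : IsStarProjection (rankOne ℂ u u) :=
    isStarProjection_rankOne_self (by simp [u, norm_smul, hx])
  have hconj : star W * rankOne ℂ u u * W = rankOne ℂ (adjoint W u) (adjoint W u) := by
    rw [star_eq_adjoint, mul_def, mul_def, comp_rankOne, rankOne_comp]
  obtain ⟨s, ⟨hs, -⟩, hsP, -⟩ := hP.2 (star W * rankOne ℂ u u * W)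
    (star_left_conjugate_nonneg hu.nonneg W) (star W * W - star W * rankOne ℂ u u * W)
    (sub_nonneg.mpr (by simpa using star_left_conjugate_le_conjugate hu.le_one W))
    (add_sub_cancel _ _)
  rw [hconj] at hsP
  have hWu : adjoint W u ≠ 0 := by
    intro h
    have : inner ℂ (adjoint W u) x = 0 := by rw [h, inner_zero_left]
    simp [u, adjoint_inner_left, hx] at this
  have hs0 : s ≠ 0 := by
    rintro rfl
    simp [hWu] at hsP
  refine ⟨√s⁻¹ • adjoint W u, ?_⟩
  rw [← real_smul_rankOne_self (inv_nonneg.mpr hs), hsP, smul_smul, inv_mul_cancel₀ hs0, one_smul]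

theorem IsRankOneProjection.exists_eq_rankOne {Q : K →L[ℂ] K} (hQ : IsRankOneProjection Q) :
    ∃ q : K, ‖q‖ = 1 ∧ Q = rankOne ℂ q q := by
  obtain ⟨hproj, hrank⟩ := hQ
  obtain ⟨_, hQ⟩ := isStarProjection_iff_eq_starProjection_range.mp hproj
  have : FiniteDimensional ℂ Q.range := Module.finite_of_finrank_eq_succ hrank
  let b := (stdOrthonormalBasis ℂ Q.range).reindex (finCongr hrank)
  refine ⟨b 0, b.norm_eq_one 0, ?_⟩
  exact hQ.trans (by rw [b.starProjection_eq_sum_rankOne, Fin.sum_univ_one])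

theorem isRankOneProjection_rankOne_self {q : K} (hq : ‖q‖ = 1) :
    IsRankOneProjection (rankOne ℂ q q) := by
  have hq0 : q ≠ 0 := norm_ne_zero_iff.mp (hq ▸ one_ne_zero)
  exact ⟨isStarProjection_rankOne_self hq,
    Module.rank_eq_one_iff_finrank_eq_one.mp (rank_rankOne hq0 hq0)⟩

theorem exists_smul_isRankOneProjection_iff [Nontrivial K] {P : K →L[ℂ] K} :
    (∃ (Q : K →L[ℂ] K) (α : ℝ), IsRankOneProjection Q ∧ 0 ≤ α ∧ P = α • Q) ↔
      ∃ v, P = rankOne ℂ v v := by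
  constructor
  · rintro ⟨Q, α, hQ, hα, rfl⟩
    obtain ⟨q, -, rfl⟩ := hQ.exists_eq_rankOne
    exact ⟨_, real_smul_rankOne_self hα q⟩
  · rintro ⟨v, rfl⟩
    obtain ⟨q, hq, hv⟩ : ∃ q : K, ‖q‖ = 1 ∧ ‖v‖ • q = v := by
      by_cases hv : v = 0
      · obtain ⟨q, hq⟩ := exists_norm_eq K (zero_le_one (α := ℝ))
        exact ⟨q, hq, by simp [hv]⟩
      · exact ⟨‖v‖⁻¹ • v, by simp [norm_smul, hv], by simp [smul_smul, hv]⟩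
    refine ⟨rankOne ℂ q q, ‖v‖ ^ 2, isRankOneProjection_rankOne_self hq, by positivity, ?_⟩
    rw [real_smul_rankOne_self (by positivity), Real.sqrt_sq (norm_nonneg v), hv]

end RankOne

theorem exists_eq_sub_of_succ_succ_eq {α : Type*} {n : ℕ} (f : Fin (n + 1) → Fin (n + 1) → α)
    (h : ∀ i j : Fin n, f i.succ j.succ = f i.castSucc j.castSucc) :
    ∃ τ : ℤ → α, ∀ i j : Fin (n + 1), f i j = τ ((i : ℤ) - (j : ℤ)) := by
  have shift : ∀ m i j : ℕ, ∀ (hi : i + m < n + 1) (hj : j + m < n + 1),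
      f ⟨i + m, hi⟩ ⟨j + m, hj⟩ = f ⟨i, by omega⟩ ⟨j, by omega⟩ := by
    intro m i j
    induction m with
    | zero => intros; rfl
    | succ m ih =>
      intro hi hj
      rw [← ih (by omega) (by omega)]
      exact h ⟨i + m, by omega⟩ ⟨j + m, by omega⟩
  refine ⟨fun m => f (Fin.ofNat (n + 1) m.toNat) (Fin.ofNat (n + 1) (-m).toNat), fun i j => ?_⟩
  have hij := shift (min i j) ((i : ℤ) - j).toNat (-((i : ℤ) - j)).toNat (by omega) (by omega)
  refine (congrArg₂ f ?_ ?_).trans (hij.trans (congrArg₂ f ?_ ?_)) <;> ext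
  · simp only; omega
  · simp only; omega
  · exact (Nat.mod_eq_of_lt (by omega)).symm
  · exact (Nat.mod_eq_of_lt (by omega)).symm

section Blocks

variable {n : ℕ} {H : Type*} [NormedAddCommGroup H] [InnerProductSpace ℂ H]

/-- The inclusion of `H` as the `i`-th summand of `ℂⁿ ⊗ H`. -/
noncomputable def blockIncl (i : Fin n) : H →L[ℂ] HilbertPower n H :=
  (PiLp.continuousLinearEquiv 2 ℂ (fun _ : Fin n => H)).symm.toContinuousLinearMap ∘L
    ContinuousLinearMap.single ℂ (fun _ : Fin n => H) i

theorem blockIncl_apply (i j : Fin n) (x : H) : blockIncl i x j = if j = i then x else 0 := by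
  simp [blockIncl]

theorem inner_blockIncl_left (i : Fin n) (x : H) (ξ : HilbertPower n H) :
    inner ℂ (blockIncl i x) ξ = inner ℂ x (ξ i) := by
  rw [PiLp.inner_apply, Finset.sum_eq_single i]
  · simp [blockIncl_apply]
  · intro j _ hj
    simp [blockIncl_apply, hj]
  · simp

theorem sum_blockIncl (ξ : HilbertPower n H) : ∑ i, blockIncl i (ξ i) = ξ := by
  ext j
  simp [blockIncl_apply]

/-- The `(i, j)` block of an operator on `ℂⁿ ⊗ H`. -/
noncomputable def block (i j : Fin n) :
    (HilbertPower n H →L[ℂ] HilbertPower n H) →ₗ[ℂ] (H →L[ℂ] H) where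
  toFun G := PiLp.proj 2 (fun _ : Fin n => H) i ∘L G ∘L blockIncl j
  map_add' _ _ := by ext; simp
  map_smul' _ _ := by ext; simp

theorem block_apply (i j : Fin n) (G : HilbertPower n H →L[ℂ] HilbertPower n H) (x : H) :
    block i j G x = G (blockIncl j x) i := rfl

theorem inner_block (i j : Fin n) (G : HilbertPower n H →L[ℂ] HilbertPower n H) (x y : H) :
    inner ℂ x (block i j G y) = inner ℂ (blockIncl i x) (G (blockIncl j y)) := by
  rw [inner_blockIncl_left, block_apply]

theorem block_ext {G G' : HilbertPower n H →L[ℂ] HilbertPower n H}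
    (h : ∀ i j, block i j G = block i j G') : G = G' := by
  ext ξ i
  rw [← sum_blockIncl ξ]
  simp only [map_sum, WithLp.ofLp_sum, Finset.sum_apply]
  exact Finset.sum_congr rfl fun j _ => DFunLike.congr_fun (h i j) (ξ j)

theorem block_kroneckerOp (a : Matrix (Fin n) (Fin n) ℂ) (x : H →L[ℂ] H) (i j : Fin n) :
    block i j (kroneckerOp a x) = a i j • x := by
  ext y
  simp [block_apply, kroneckerOp_apply, blockIncl_apply, apply_ite x]

theorem spatialRep_tmul (a : toeplitz n) (x : H →L[ℂ] H) :
    spatialRep n H (a ⊗ₜ x) = kroneckerOp (a : Matrix (Fin n) (Fin n) ℂ) x := rfl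

theorem block_spatialRep_universalToeplitz_tmul (z : Circle) (P : H →L[ℂ] H) (i j : Fin n) :
    block i j (spatialRep n H (universalToeplitz n z ⊗ₜ P)) = (z : ℂ) ^ ((i : ℤ) - j) • P := by
  rw [spatialRep_tmul, block_kroneckerOp]
  rfl

theorem spatialRep_injective (n : ℕ) (H : Type*) [NormedAddCommGroup H] [InnerProductSpace ℂ H] :
    Function.Injective (spatialRep n H) := by
  let entries : toeplitz n ⊗[ℂ] (H →L[ℂ] H) →ₗ[ℂ] Matrix (Fin n) (Fin n) (H →L[ℂ] H) :=
    (matrixEquivTensor (Fin n) ℂ (H →L[ℂ] H)).symm.toLinearMap ∘ₗ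
      (TensorProduct.comm ℂ _ _).toLinearMap ∘ₗ (toeplitz n).subtype.rTensor (H →L[ℂ] H)
  have hentries : Function.Injective entries :=
    (matrixEquivTensor (Fin n) ℂ (H →L[ℂ] H)).symm.injective.comp
      ((TensorProduct.comm ℂ _ _).injective.comp
        (Module.Flat.rTensor_preserves_injective_linearMap _ (toeplitz n).injective_subtype))
  have hblock : ∀ T i j, entries T i j = block i j (spatialRep n H T) := by
    intro T i j
    induction T with
    | zero => simp
    | add S T hS hT => simp only [map_add, Matrix.add_apply, hS, hT]
    | tmul a x => simp [entries, spatialRep_tmul, block_kroneckerOp, Algebra.algebraMap_eq_smul_one]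
  intro S T h
  exact hentries (Matrix.ext fun i j => by rw [hblock, hblock, h])

/-- The operators on `ℂⁿ ⊗ H` whose blocks are constant along the diagonals. -/
def IsBlockToeplitz (G : HilbertPower n H →L[ℂ] HilbertPower n H) : Prop :=
  ∃ τ : ℤ → (H →L[ℂ] H), ∀ i j : Fin n, block i j G = τ ((i : ℤ) - (j : ℤ))

/-- The Toeplitz matrix with ones on the `m`-th diagonal and zeros elsewhere. -/
def toeplitzDiagonal (n : ℕ) (m : ℤ) : toeplitz n :=
  ⟨Matrix.of fun k l => if (k : ℤ) - (l : ℤ) = m then 1 else 0,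
    fun j => if j = m then 1 else 0, fun _ _ => rfl⟩

theorem block_spatialRep_toeplitzDiagonal_tmul (m : ℤ) (x : H →L[ℂ] H) (i j : Fin n) :
    block i j (spatialRep n H (toeplitzDiagonal n m ⊗ₜ x)) =
      if (i : ℤ) - (j : ℤ) = m then x else 0 := by
  simp [spatialRep_tmul, block_kroneckerOp, toeplitzDiagonal]

theorem isBlockToeplitz_iff_exists_spatialRep_eq {G : HilbertPower n H →L[ℂ] HilbertPower n H} :
    IsBlockToeplitz G ↔ ∃ T, spatialRep n H T = G := by
  constructor
  · rintro ⟨τ, hτ⟩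
    refine ⟨∑ m ∈ Finset.Ioo (-n : ℤ) n, toeplitzDiagonal n m ⊗ₜ τ m, block_ext fun i j => ?_⟩
    have hij : (i : ℤ) - j ∈ Finset.Ioo (-n : ℤ) n := Finset.mem_Ioo.mpr (by omega)
    simp only [map_sum, block_spatialRep_toeplitzDiagonal_tmul, Finset.sum_ite_eq, hij, if_true, hτ]
  · rintro ⟨T, rfl⟩
    induction T with
    | zero => exact ⟨0, fun i j => by simp⟩
    | tmul a x =>
      obtain ⟨τ, hτ⟩ := a.2
      exact ⟨fun m => τ m • x, fun i j => by rw [spatialRep_tmul, block_kroneckerOp, hτ]⟩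
    | add S T hS hT =>
      obtain ⟨σ, hσ⟩ := hS
      obtain ⟨τ, hτ⟩ := hT
      exact ⟨σ + τ, fun i j => by rw [map_add, map_add, hσ, hτ, Pi.add_apply]⟩

theorem isBlockToeplitz_iff_block_succ_succ_eq
    {G : HilbertPower (n + 1) H →L[ℂ] HilbertPower (n + 1) H} :
    IsBlockToeplitz G ↔ ∀ i j : Fin n, block i.succ j.succ G = block i.castSucc j.castSucc G := by
  refine ⟨?_, exists_eq_sub_of_succ_succ_eq fun i j => block i j G⟩
  rintro ⟨τ, hτ⟩ i j
  rw [hτ, hτ]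
  congr 1
  simp

variable [CompleteSpace H]

open ContinuousLinearMap

theorem block_eq_adjoint_comp (i j : Fin n) (G : HilbertPower n H →L[ℂ] HilbertPower n H) :
    block i j G = adjoint (blockIncl i) ∘L G ∘L blockIncl j := by
  ext y
  refine ext_inner_left ℂ fun x => ?_
  rw [inner_block, comp_apply, adjoint_inner_right, comp_apply]

theorem block_star (i j : Fin n) (G : HilbertPower n H →L[ℂ] HilbertPower n H) :
    block i j (star G) = star (block j i G) := by
  simp only [block_eq_adjoint_comp, star_eq_adjoint, adjoint_comp, adjoint_adjoint, comp_assoc]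

theorem IsBlockToeplitz.star {G : HilbertPower n H →L[ℂ] HilbertPower n H}
    (hG : IsBlockToeplitz G) : IsBlockToeplitz (star G) := by
  obtain ⟨τ, hτ⟩ := hG
  exact ⟨fun m => Star.star (τ (-m)), fun i j => by rw [block_star, hτ, ← neg_sub]⟩

end Blocks

section Shift

variable {n : ℕ} {H : Type*} [NormedAddCommGroup H] [InnerProductSpace ℂ H] [CompleteSpace H]

open ContinuousLinearMap

theorem inner_block_star_mul (i j : Fin n) (V W : HilbertPower n H →L[ℂ] HilbertPower n H)
    (x y : H) : inner ℂ x (block i j (star V * W) y) =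
      inner ℂ (V (blockIncl i x)) (W (blockIncl j y)) := by
  rw [inner_block, mul_def, comp_apply, star_eq_adjoint, adjoint_inner_right]

theorem exists_isBlockToeplitz_star_mul_mul
    {W : HilbertPower (n + 1) H →L[ℂ] HilbertPower (n + 1) H} (hW : IsBlockToeplitz (star W * W)) :
    ∃ S, ‖S‖ ≤ 1 ∧ IsBlockToeplitz (star W * S * W) ∧ ∀ (i : Fin (n + 1)) (j : Fin n),
      block i j.castSucc (star W * S * W) = block i j.succ (star W * W) := by
  rw [isBlockToeplitz_iff_block_succ_succ_eq] at hW
  obtain ⟨S, hS, hSW, hSW'⟩ := exists_norm_le_one_apply_eq_of_gram_eq (𝕜 := ℂ)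
    (a := fun p : Fin n × H => W (blockIncl p.1.castSucc p.2))
    (b := fun p : Fin n × H => W (blockIncl p.1.succ p.2)) fun p q => by
      rw [← inner_block_star_mul, ← inner_block_star_mul, hW]
  simp only [Prod.forall] at hSW hSW'
  have block_castSucc : ∀ (i : Fin (n + 1)) (j : Fin n),
      block i j.castSucc (star W * S * W) = block i j.succ (star W * W) := by
    intro i j
    ext y
    refine ext_inner_left ℂ fun x => ?_
    rw [mul_assoc, inner_block_star_mul, inner_block_star_mul, mul_def, comp_apply, hSW]
  refine ⟨S, hS, isBlockToeplitz_iff_block_succ_succ_eq.mpr fun i j => ?_, block_castSucc⟩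
  rw [block_castSucc]
  ext y
  refine ext_inner_left ℂ fun x => ?_
  rw [mul_assoc, inner_block_star_mul, inner_block_star_mul, mul_def, comp_apply,
    ← adjoint_inner_left, hSW']

theorem IsPureElement.exists_block_succ_eq_smul {T : toeplitz (n + 1) ⊗[ℂ] (H →L[ℂ] H)}
    (hT : IsPureElement (minPositiveCone (n + 1) H) T) :
    ∃ a : ℂ, ∀ (i : Fin (n + 1)) (j : Fin n),
      block i j.succ (spatialRep (n + 1) H T) =
        a • block i j.castSucc (spatialRep (n + 1) H T) := by
  obtain ⟨W, hW⟩ := exists_eq_star_mul_self_of_isPositive hT.1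
  obtain ⟨S, hS, hX, hblock⟩ := exists_isBlockToeplitz_star_mul_mul
    (hW ▸ isBlockToeplitz_iff_exists_spatialRep_eq.mpr ⟨T, rfl⟩)
  obtain ⟨x, hx⟩ := isBlockToeplitz_iff_exists_spatialRep_eq.mp hX
  obtain ⟨y, hy⟩ := isBlockToeplitz_iff_exists_spatialRep_eq.mp hX.star
  obtain ⟨a, rfl⟩ := hT.exists_eq_complex_smul
    (fun _ => (nonneg_iff_isPositive _).mp) hW hS hx (hy.trans (by rw [hx]))
  refine ⟨a, fun i j => ?_⟩
  rw [hW, ← hblock, ← hx, ← hW, map_smul, map_smul]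

theorem block_eq_smul_block_zero_zero
    {G : HilbertPower (n + 1) H →L[ℂ] HilbertPower (n + 1) H} (hG : IsSelfAdjoint G) {a : ℂ}
    (h : ∀ (i : Fin (n + 1)) (j : Fin n), block i j.succ G = a • block i j.castSucc G)
    (i j : Fin (n + 1)) : block i j G = (star a ^ (i : ℕ) * a ^ (j : ℕ)) • block 0 0 G := by
  have hrow : ∀ (i : Fin n) (j : Fin (n + 1)),
      block i.succ j G = star a • block i.castSucc j G := by
    intro i j
    rw [← hG.star_eq, block_star, h, star_smul, block_star]
  induction j using Fin.induction with
  | zero =>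
    induction i using Fin.induction with
    | zero => simp
    | succ i ih => rw [hrow, ih, smul_smul, Fin.val_succ, Fin.val_castSucc, pow_succ']; ring_nf
  | succ j ih => rw [h, ih, smul_smul, Fin.val_succ, Fin.val_castSucc, pow_succ']; ring_nf

theorem exists_circle_block_eq_zpow_smul
    {G : HilbertPower (n + 1) H →L[ℂ] HilbertPower (n + 1) H} (hG : IsSelfAdjoint G)
    (hGt : IsBlockToeplitz G) {a : ℂ}
    (h : ∀ (i : Fin (n + 1)) (j : Fin n), block i j.succ G = a • block i j.castSucc G) :
    ∃ z : Circle, ∀ i j : Fin (n + 1), block i j G = (z : ℂ) ^ ((i : ℤ) - j) • block 0 0 G := by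
  have hblock := block_eq_smul_block_zero_zero hG h
  obtain _ | n := n
  · exact ⟨1, fun i j => by simp [Fin.fin_one_eq_zero i, Fin.fin_one_eq_zero j]⟩
  by_cases hB : block 0 0 G = 0
  · exact ⟨1, fun i j => by rw [hblock, hB, smul_zero, smul_zero]⟩
  have hdiag : (star a * a) • block 0 0 G = block 0 0 G := by
    simpa using (hblock 1 1).symm.trans (isBlockToeplitz_iff_block_succ_succ_eq.mp hGt 0 0)
  have haa : star a * a = 1 := smul_left_injective ℂ hB (by simpa using hdiag)
  have ha : ‖star a‖ = 1 := by
    rw [norm_star, CStarRing.norm_of_mem_unitary ⟨haa, by rwa [mul_comm]⟩]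
  refine ⟨⟨star a, mem_sphere_zero_iff_norm.mpr ha⟩, fun i j => ?_⟩
  rw [hblock, zpow_sub₀ (left_ne_zero_of_mul_eq_one haa), zpow_natCast, zpow_natCast,
    div_eq_mul_inv, ← inv_pow, ← eq_inv_of_mul_eq_one_right haa]

theorem IsPureElement.exists_eq_universalToeplitz_tmul {T : toeplitz (n + 1) ⊗[ℂ] (H →L[ℂ] H)}
    (hT : IsPureElement (minPositiveCone (n + 1) H) T) :
    ∃ (z : Circle) (P : H →L[ℂ] H), T = universalToeplitz (n + 1) z ⊗ₜ P := by
  obtain ⟨a, ha⟩ := hT.exists_block_succ_eq_smul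
  obtain ⟨z, hz⟩ := exists_circle_block_eq_zpow_smul (IsPositive.isSelfAdjoint hT.1)
    (isBlockToeplitz_iff_exists_spatialRep_eq.mpr ⟨T, rfl⟩) ha
  refine ⟨z, block 0 0 (spatialRep (n + 1) H T),
    spatialRep_injective _ _ (block_ext fun i j => ?_)⟩
  rw [hz, block_spatialRep_universalToeplitz_tmul]

end Shift

section Character

variable {n : ℕ} {H : Type*} [NormedAddCommGroup H] [InnerProductSpace ℂ H]

open ContinuousLinearMap InnerProductSpace

/-- The embedding `x ↦ (x, z x, …, zⁿ⁻¹ x)` of `H` into `ℂⁿ ⊗ H`, through which the operators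
`T_n(z) ⊗ P` factor. -/
noncomputable def characterIncl (n : ℕ) (z : Circle) : H →L[ℂ] HilbertPower n H :=
  ∑ i : Fin n, (z : ℂ) ^ (i : ℕ) • blockIncl i

theorem characterIncl_apply (z : Circle) (x : H) (i : Fin n) :
    characterIncl n z x i = (z : ℂ) ^ (i : ℕ) • x := by
  simp [characterIncl, blockIncl_apply]

theorem mk_universalToeplitz_injective (z : Circle) : Function.Injective
    (TensorProduct.mk ℂ _ (H →L[ℂ] H) (universalToeplitz (n + 1) z)) := by
  intro P P' h
  simpa [block_spatialRep_universalToeplitz_tmul] using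
    congrArg (fun T => block 0 0 (spatialRep (n + 1) H T)) h

variable [CompleteSpace H]

theorem adjoint_characterIncl_blockIncl (z : Circle) (x : H) (i : Fin n) :
    adjoint (characterIncl n z) (blockIncl i x) = star (z : ℂ) ^ (i : ℕ) • x := by
  refine ext_inner_right ℂ fun y => ?_
  rw [adjoint_inner_left, inner_blockIncl_left, characterIncl_apply, inner_smul_right,
    inner_smul_left, ← RCLike.star_def, star_pow, star_star]

theorem spatialRep_universalToeplitz_tmul (z : Circle) (P : H →L[ℂ] H) :
    spatialRep n H (universalToeplitz n z ⊗ₜ P) =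
      characterIncl n z ∘L P ∘L adjoint (characterIncl n z) := by
  refine block_ext fun i j => ?_
  ext x
  rw [block_spatialRep_universalToeplitz_tmul, block_apply, comp_apply, comp_apply,
    characterIncl_apply, adjoint_characterIncl_blockIncl, map_smul, smul_smul, smul_apply,
    zpow_sub₀ z.coe_ne_zero, zpow_natCast, zpow_natCast, div_eq_mul_inv, ← inv_pow,
    ← Circle.coe_inv, Circle.coe_inv_eq_conj, RCLike.star_def]

theorem comap_mk_universalToeplitz_minPositiveCone (z : Circle) :
    (minPositiveCone (n + 1) H).comap
        ((TensorProduct.mk ℂ _ _ (universalToeplitz (n + 1) z)).restrictScalars ℝ) =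
      ConvexCone.positive ℝ (H →L[ℂ] H) := by
  ext P
  rw [ConvexCone.mem_positive, nonneg_iff_isPositive]
  change (spatialRep (n + 1) H (universalToeplitz (n + 1) z ⊗ₜ P)).IsPositive ↔ _
  constructor
  · intro h
    have := h.adjoint_conj (blockIncl 0)
    rwa [← block_eq_adjoint_comp, block_spatialRep_universalToeplitz_tmul, sub_self, zpow_zero,
      one_smul] at this
  · intro h
    rw [spatialRep_universalToeplitz_tmul]
    exact h.conj_adjoint _

theorem isPureElement_of_universalToeplitz_tmul {z : Circle} {P : H →L[ℂ] H}
    (hP : IsPureElement (minPositiveCone (n + 1) H) (universalToeplitz (n + 1) z ⊗ₜ P)) :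
    IsPureElement (ConvexCone.positive ℝ (H →L[ℂ] H)) P := by
  let f := (TensorProduct.mk ℂ _ (H →L[ℂ] H) (universalToeplitz (n + 1) z)).restrictScalars ℝ
  rw [← comap_mk_universalToeplitz_minPositiveCone z]
  exact IsPureElement.comap (F := toeplitz (n + 1) ⊗[ℂ] (H →L[ℂ] H)) (f := f)
    (mk_universalToeplitz_injective z) hP

theorem isPureElement_universalToeplitz_tmul_rankOne_self (z : Circle) (v : H) :
    IsPureElement (minPositiveCone n H) (universalToeplitz n z ⊗ₜ rankOne ℂ v v) := by
  refine isPureElement_of_map_eq_rankOne_self (f := (spatialRep n H).restrictScalars ℝ)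
    (v := characterIncl n z v) (spatialRep_injective n H) (fun _ => Iff.rfl) ?_
  rw [LinearMap.restrictScalars_apply, spatialRep_universalToeplitz_tmul, rankOne_comp,
    comp_rankOne, adjoint_adjoint]

theorem isPureElement_minPositiveCone_iff {T : toeplitz n ⊗[ℂ] (H →L[ℂ] H)} :
    IsPureElement (minPositiveCone n H) T ↔
      ∃ (z : Circle) (v : H), T = universalToeplitz n z ⊗ₜ rankOne ℂ v v := by
  constructor
  · intro hT
    cases n with
    | zero => exact ⟨1, 0, spatialRep_injective 0 H (Subsingleton.elim _ _)⟩
    | succ n =>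
      obtain ⟨z, P, rfl⟩ := hT.exists_eq_universalToeplitz_tmul
      obtain ⟨v, rfl⟩ := (isPureElement_of_universalToeplitz_tmul hT).exists_eq_rankOne_self
      exact ⟨z, v, rfl⟩
  · rintro ⟨z, v, rfl⟩
    exact isPureElement_universalToeplitz_tmul_rankOne_self _ _

end Character

theorem mainTheorem2 (n : ℕ) (H : Type*) [NormedAddCommGroup H] [InnerProductSpace ℂ H]
    [CompleteSpace H] [Nontrivial H] (T : toeplitz n ⊗[ℂ] (H →L[ℂ] H)) :
    IsPureElement (minPositiveCone n H) T ↔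
      ∃ (z : Circle) (Q : H →L[ℂ] H) (α : ℝ), IsRankOneProjection Q ∧ 0 ≤ α ∧
        T = universalToeplitz n z⁻¹ ⊗ₜ[ℂ] (α • Q) := by
  rw [isPureElement_minPositiveCone_iff]
  refine ((Equiv.inv Circle).exists_congr fun z => ?_).symm
  simp only [Equiv.inv_apply]
  constructor
  · rintro ⟨Q, α, hQ, hα, rfl⟩
    obtain ⟨v, hv⟩ := exists_smul_isRankOneProjection_iff.mp ⟨Q, α, hQ, hα, rfl⟩
    exact ⟨v, by rw [hv]⟩
  · rintro ⟨v, rfl⟩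
    obtain ⟨Q, α, hQ, hα, hv⟩ := exists_smul_isRankOneProjection_iff.mpr ⟨v, rfl⟩
    exact ⟨Q, α, hQ, hα, by rw [hv]⟩
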